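/- A planted plane tree is a finite rooted tree in which every node may have any finite number of children and the children of each node are linearly ordered from left to right; trees are regarded as posets under the ancestor order. Let $\mathcal{T}_n$ be the finite family of all planted plane trees with $n$ nodes. An embedding of a planted plane tree $S$ into a planted plane tree $T$ is a subposet of $T$ (a set of nodes of $T$ with the induced ancestor order) that is isomorphic to $S$ by an isomorphism which preserves the left-to-right order of the children of each node of $S$; it is good if it contains the root of $T$. Write $S\subseteq T$ if there is at least one embedding of $S$ into $T$. Let $a_T(S)$ and $g_T(S)$ be the numbers of all and of good embeddings of $S$ into $T$, and put $a_{\mathcal{T}_n}(S)=\sum_{T\in\mathcal{T}_n}a_T(S)$ and $g_{\mathcal{T}_n}(S)=\sum_{T\in\mathcal{T}_n}g_T(S)$. Theorem. (i) Let $S$ be a planted plane tree with $m$ nodes and $l$ leaves (nodes without children), and let $k=\frac{m+l-2}{2}$. If $m>1$, then $$\lim_{n\to\infty}\sqrt n\,\frac{g_{\mathcal{T}_n}(S)}{a_{\mathcal{T}_n}(S)}=\frac{2\,\Gamma(k+1/2)}{\Gamma(k)},$$ and if $m=1$, then this limit exists and equals $0$. (ii) If $S_1,S_2$ are planted plane trees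 with $S_1\subseteq S_2$, then both of the following limits exist and $$\lim_{n\to\infty}\sqrt n\,\frac{g_{\mathcal{T}_n}(S_1)}{a_{\mathcal{T}_n}(S_1)}\le\lim_{n\to\infty}\sqrt n\,\frac{g_{\mathcal{T}_n}(S_2)}{a_{\mathcal{T}_n}(S_2)}.$$ -/

import Mathlib

open Filter Topology

/-- Planted plane trees: a root together with the left-to-right list of the subtrees attached to
it. -/
inductive PlaneTree : Type where
  | node (children : List PlaneTree) : PlaneTree

namespace PlaneTree

/-- The number of nodes of a tree. -/
def size : PlaneTree → ℕ
  | node ts => 1 + (ts.map size).sum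

/-- The number of leaves (nodes without children) of a tree. -/
def leaves : PlaneTree → ℕ
  | node [] => 1
  | node (t :: ts) => leaves t + (ts.map leaves).sum

/-- The nodes of a tree are named by their addresses: the root is `[]`, and `i :: p` is the node
with address `p` in the `i`-th subtree (from the left, counting from `0`) of the root. -/
def IsNode : PlaneTree → List ℕ → Prop
  | _, [] => True
  | node ts, i :: p => ∃ h : i < ts.length, IsNode ts[i] p

/-- The type of nodes of `T`. -/
def Node (T : PlaneTree) : Type := {p : List ℕ // T.IsNode p}

/-- The root of `T`. -/
def root (T : PlaneTree) : T.Node := ⟨[], by cases T; trivial⟩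

/-- The tree poset: `u` is `v` or an ancestor of `v`. -/
def Node.AncestorEq {T : PlaneTree} (u v : T.Node) : Prop := u.1 <+: v.1

/-- The node `u` lies to the left of the node `v`: the two nodes lie in the subtrees of two
different children of a common ancestor, that of `u` being further left. -/
def Node.LeftOf {T : PlaneTree} (u v : T.Node) : Prop :=
  ∃ (r : List ℕ) (i j : ℕ) (p q : List ℕ), i < j ∧ u.1 = r ++ i :: p ∧ v.1 = r ++ j :: q

/-- `v` is a child of `u`. -/
def Node.IsChild {T : PlaneTree} (u v : T.Node) : Prop := ∃ i : ℕ, v.1 = u.1 ++ [i]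

/-- `φ` is an isomorphism of posets from `S` onto a subposet of `T` that keeps the left-to-right
order of the children of each node of `S`. -/
structure IsPlaneEmbedding {S T : PlaneTree} (φ : S.Node → T.Node) : Prop where
  ancestorEq_iff : ∀ u v : S.Node, (φ u).AncestorEq (φ v) ↔ u.AncestorEq v
  children_leftOf : ∀ w u v : S.Node, w.IsChild u → w.IsChild v → u.LeftOf v →
    (φ u).LeftOf (φ v)

/-- The embeddings of `S` into `T`, each one given by the set of nodes of `T` that it occupies. -/
def embeddings (S T : PlaneTree) : Set (Set T.Node) :=
  {X | ∃ φ : S.Node → T.Node, IsPlaneEmbedding φ ∧ Set.range φ = X}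

/-- The good embeddings of `S` into `T`: those that contain the root of `T`. -/
def goodEmbeddings (S T : PlaneTree) : Set (Set T.Node) :=
  {X | X ∈ embeddings S T ∧ T.root ∈ X}

/-- There is at least one embedding of `S` into `T`. -/
def Embeds (S T : PlaneTree) : Prop := (embeddings S T).Nonempty

/-- A tree has finitely many nodes, so the cardinalities below are those of finite sets. -/
instance finite_node : ∀ T : PlaneTree, Finite T.Node
  | node ts => by
    have ih : ∀ i : Fin ts.length, Finite (ts[i]).Node := fun i => finite_node ts[i]
    let f : Option (Σ i : Fin ts.length, (ts[i]).Node) → (node ts).Node := fun x =>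
      match x with
      | none => (node ts).root
      | some ⟨i, v⟩ => ⟨i.1 :: v.1, ⟨i.2, v.2⟩⟩
    refine Finite.of_surjective f ?_
    rintro ⟨p, hp⟩
    cases p with
    | nil => exact ⟨none, rfl⟩
    | cons i p =>
      obtain ⟨h, hp⟩ := hp
      exact ⟨some ⟨⟨i, h⟩, ⟨p, hp⟩⟩, rfl⟩
  termination_by T => sizeOf T
  decreasing_by
    have := List.sizeOf_lt_of_mem (List.getElem_mem i.2)
    simp only [PlaneTree.node.sizeOf_spec, Fin.getElem_fin]
    omega

/-- The number `a_T(S)` of all embeddings of `S` into `T`. -/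
noncomputable def numEmb (S T : PlaneTree) : ℕ := (embeddings S T).ncard

/-- The number `g_T(S)` of good embeddings of `S` into `T`. -/
noncomputable def numGoodEmb (S T : PlaneTree) : ℕ := (goodEmbeddings S T).ncard

theorem size_pos (T : PlaneTree) : 0 < T.size := by
  cases T; rw [size]; omega

theorem length_le_sum_size (ts : List PlaneTree) : ts.length ≤ (ts.map size).sum := by
  induction ts with
  | nil => simp
  | cons t ts ih =>
    have := size_pos t
    simp only [List.length_cons, List.map_cons, List.sum_cons]
    omega

theorem finite_size_le (n : ℕ) : {T : PlaneTree | T.size ≤ n}.Finite := by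
  induction n with
  | zero =>
    refine Set.finite_empty.subset fun T hT => ?_
    have := size_pos T
    simp only [Set.mem_ofPred_eq] at hT
    omega
  | succ n ih =>
    have : Finite {T : PlaneTree | T.size ≤ n} := ih
    refine ((List.finite_length_le {T : PlaneTree | T.size ≤ n} n).image
      (fun l => node (l.map Subtype.val))).subset ?_
    rintro ⟨ts⟩ hT
    simp only [Set.mem_ofPred_eq, size] at hT
    have hmem : ∀ t ∈ ts, t.size ≤ n := fun t ht => by
      have := List.le_sum_of_mem (List.mem_map_of_mem (f := size) ht)
      omega
    refine ⟨ts.attach.map fun t => ⟨t.1, hmem t.1 t.2⟩, ?_, ?_⟩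
    · have := length_le_sum_size ts
      simp only [Set.mem_ofPred_eq, List.length_map, List.length_attach]
      omega
    · simp [Function.comp_def]

/-- The family `𝒯ₙ` of all planted plane trees with `n` nodes. -/
noncomputable def family (n : ℕ) : Finset PlaneTree :=
  Set.Finite.toFinset (s := {T : PlaneTree | T.size = n})
    ((finite_size_le n).subset fun _ hT => le_of_eq hT)

/-- The cumulative number of all embeddings of `S` into the members of `𝒯ₙ`. -/
noncomputable def familyNumEmb (n : ℕ) (S : PlaneTree) : ℕ := ∑ T ∈ family n, numEmb S T

/-- The cumulative number of good embeddings of `S` into the members of `𝒯ₙ`. -/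
noncomputable def familyNumGoodEmb (n : ℕ) (S : PlaneTree) : ℕ := ∑ T ∈ family n, numGoodEmb S T

/-- The sequence `√n * g(S) / a(S)` for the family `𝒯ₙ`. -/
noncomputable def scaledRatio (S : PlaneTree) (n : ℕ) : ℝ :=
  √(n : ℝ) * ((familyNumGoodEmb n S : ℝ) / (familyNumEmb n S : ℝ))

end PlaneTree

/-!
Recording an embedding by the set of nodes it occupies, and cutting the target forest after its
first tree, gives a convolution recursion for the number of copies of one forest in another. For
the generating functions over all trees it becomes a linear recursion with coefficients in
`ℝ[√(1 - 4X)]`, so that by induction these generating functions are Laurent polynomials in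
`√(1 - 4X)` with a positive leading coefficient. The order of the pole is `m + l - 2` for the good
embeddings of `S`, and passing to all embeddings raises it by one and halves the leading
coefficient. As the coefficient of `Xⁿ` in `(1 - 4X) ^ (-s)` is asymptotic to
`4 ^ n * n ^ (s - 1) / Γ(s)` by Euler's limit formula, the scaled ratio tends to
`2 Γ(k + 1/2) / Γ(k)`. This is increasing in `k` because `Γ` is log-convex, and `m + l` does not
decrease along an embedding, again by the recursion.
-/

theorem injOn_union_of_disjoint {α : Type*} {B₀ B₁ : Set α} (h : Disjoint B₀ B₁) :
    Set.InjOn (fun X : Set α × Set α => X.1 ∪ X.2) {X | X.1 ⊆ B₀ ∧ X.2 ⊆ B₁} := by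
  have hfst {X : Set α × Set α} (hX : X.1 ⊆ B₀ ∧ X.2 ⊆ B₁) : (X.1 ∪ X.2) ∩ B₀ = X.1 := by
    rw [Set.union_inter_distrib_right, Set.inter_eq_left.2 hX.1,
      (h.symm.mono_left hX.2).inter_eq, Set.union_empty]
  have hsnd {X : Set α × Set α} (hX : X.1 ⊆ B₀ ∧ X.2 ⊆ B₁) : (X.1 ∪ X.2) ∩ B₁ = X.2 := by
    rw [Set.union_inter_distrib_right, Set.inter_eq_left.2 hX.2, (h.mono_left hX.1).inter_eq,
      Set.empty_union]
  intro X hX Y hY (hXY : X.1 ∪ X.2 = Y.1 ∪ Y.2)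
  exact Prod.ext (by rw [← hfst hX, hXY, hfst hY]) (by rw [← hsnd hX, hXY, hsnd hY])

theorem sub_le_sub_of_convexOn {s : Set ℝ} {f : ℝ → ℝ} (hf : ConvexOn ℝ s f) {x y h : ℝ}
    (hx : x ∈ s) (hyh : y + h ∈ s) (hxy : x ≤ y) (hh : 0 < h) :
    f (x + h) - f x ≤ f (y + h) - f y := by
  have hmem {z} (hxz : x ≤ z) (hzy : z ≤ y + h) : z ∈ s := hf.1.ordConnected.out hx hyh ⟨hxz, hzy⟩
  have hleft := hf.secant_mono hx (hmem (z := x + h) (by linarith) (by linarith)) hyh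
    (by linarith) (by linarith) (by linarith)
  have hright := hf.secant_mono hyh hx (hmem hxy (by linarith))
    (by linarith) (by linarith) hxy
  rw [← neg_div_neg_eq, neg_sub, neg_sub, ← neg_div_neg_eq (f y - _), neg_sub, neg_sub] at hright
  have hsecant := hleft.trans hright
  rwa [add_sub_cancel_left, add_sub_cancel_left, div_le_div_iff_of_pos_right hh] at hsecant

/-! ### Coefficient asymptotics of Laurent polynomials in `√(1 - aX)` -/

section LaurentAsymptotics

theorem multichoose_eq_prod_div_factorial (s : ℝ) (n : ℕ) :
    Ring.multichoose s n = (∏ j ∈ Finset.range n, (s + j)) / n.factorial := by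
  have hprod : (ascPochhammer ℝ n).eval s = ∏ j ∈ Finset.range n, (s + j) := by
    induction n with
    | zero => simp
    | succ n ih => rw [ascPochhammer_succ_eval, ih, Finset.prod_range_succ]
  rw [eq_div_iff (Nat.cast_ne_zero.2 n.factorial_ne_zero), mul_comm, ← nsmul_eq_mul,
    Ring.factorial_nsmul_multichoose_eq_ascPochhammer, Polynomial.ascPochhammer_smeval_eq_eval,
    hprod]

theorem tendsto_multichoose_mul_rpow (s : ℝ) :
    Tendsto (fun n : ℕ => Ring.multichoose s n * (n : ℝ) ^ (1 - s)) atTop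
      (𝓝 (Real.Gamma s)⁻¹) := by
  by_cases hs : ∃ m : ℕ, s = -m
  · obtain ⟨m, hm⟩ := hs
    rw [(Real.Gamma_eq_zero_iff s).2 ⟨m, hm⟩, inv_zero]
    refine tendsto_const_nhds.congr' ?_
    filter_upwards [eventually_gt_atTop m] with n hn
    rw [multichoose_eq_prod_div_factorial,
      Finset.prod_eq_zero (Finset.mem_range.2 hn) (by rw [hm, neg_add_cancel]), zero_div, zero_mul]
  · have hadd_ne (n : ℕ) : s + n ≠ 0 := fun h => hs ⟨n, eq_neg_of_add_eq_zero_left h⟩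
    have hlim := (tendsto_natCast_div_add_atTop s).mul
      ((Real.GammaSeq_tendsto_Gamma s).inv₀ (mt (Real.Gamma_eq_zero_iff s).1 hs))
    rw [one_mul] at hlim
    refine hlim.congr' ?_
    filter_upwards [eventually_gt_atTop 0] with n hn
    have hpos : (0 : ℝ) < n := Nat.cast_pos.2 hn
    have hprod : ∏ j ∈ Finset.range n, (s + j) ≠ 0 := Finset.prod_ne_zero_iff.2 fun j _ => hadd_ne j
    have hfactorial : (n.factorial : ℝ) ≠ 0 := Nat.cast_ne_zero.2 n.factorial_ne_zero
    rw [multichoose_eq_prod_div_factorial, Real.GammaSeq, Finset.prod_range_succ,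
      Real.rpow_sub hpos, Real.rpow_one, add_comm (n : ℝ)]
    have := hadd_ne n
    field_simp

open PowerSeries

/-- The power series `(1 - aX) ^ r`. -/
noncomputable def rpowSeries (a r : ℝ) : ℝ⟦X⟧ :=
  rescale (-a) (binomialSeries ℝ r)

theorem rpowSeries_add (a r s : ℝ) : rpowSeries a (r + s) = rpowSeries a r * rpowSeries a s := by
  rw [rpowSeries, binomialSeries_add, map_mul, rpowSeries, rpowSeries]

theorem rpowSeries_zero (a : ℝ) : rpowSeries a 0 = 1 := by
  rw [rpowSeries, binomialSeries_zero, map_one]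

theorem rpowSeries_one (a : ℝ) : rpowSeries a 1 = 1 - C a * X := by
  have hone : PowerSeries.binomialSeries ℝ (1 : ℝ) = 1 + X := by
    simpa using binomialSeries_nat (R := ℝ) (A := ℝ) 1
  rw [rpowSeries, hone, map_add, map_one, rescale_X, map_neg, neg_mul, sub_eq_add_neg]

theorem rpowSeries_pow (a r : ℝ) (n : ℕ) : rpowSeries a r ^ n = rpowSeries a (n * r) := by
  induction n with
  | zero => rw [pow_zero, Nat.cast_zero, zero_mul, rpowSeries_zero]
  | succ n ih => rw [pow_succ, ih, ← rpowSeries_add, Nat.cast_succ, add_one_mul]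

theorem constantCoeff_rpowSeries (a r : ℝ) : constantCoeff (rpowSeries a r) = 1 := by
  rw [rpowSeries, ← coeff_zero_eq_constantCoeff_apply, coeff_rescale, pow_zero, one_mul,
    coeff_zero_eq_constantCoeff_apply, binomialSeries_constantCoeff]

theorem coeff_rpowSeries (a r : ℝ) (n : ℕ) :
    coeff n (rpowSeries a r) = a ^ n * Ring.multichoose (-r) n := by
  have hchoose : Ring.choose r n = (-1) ^ n * Ring.multichoose (-r) n := by
    rw [← neg_neg r, Ring.choose_neg', neg_neg, Units.smul_def, zsmul_eq_mul,
      Int.cast_negOnePow_natCast]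
  rw [rpowSeries, coeff_rescale, binomialSeries_coeff, hchoose, smul_eq_mul, mul_one, ← mul_assoc,
    ← mul_pow, mul_neg_one, neg_neg]

section HasLaurent

variable {R A : Type*} [CommSemiring R] [CommSemiring A] [Algebra R A]

/-- `f` is a Laurent polynomial in `s` whose exponents are at least `-e` and whose coefficient at
`s⁻ᵉ` is `c`. The powers of `s` are cleared, so that `s` need not be invertible. -/
def HasLaurent (s f : A) (e : ℕ) (c : R) : Prop :=
  ∃ Q : Polynomial R, Q.coeff 0 = c ∧ f * s ^ e = Polynomial.aeval s Q

namespace HasLaurent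

variable {s f g : A} {d e : ℕ} {b c : R}

theorem mul (hf : HasLaurent s f d b) (hg : HasLaurent s g e c) :
    HasLaurent s (f * g) (d + e) (b * c) := by
  obtain ⟨P, rfl, hP⟩ := hf
  obtain ⟨Q, rfl, hQ⟩ := hg
  exact ⟨P * Q, Polynomial.mul_coeff_zero P Q, by rw [map_mul, ← hP, ← hQ]; ring⟩

theorem add (hf : HasLaurent s f e b) (hg : HasLaurent s g e c) :
    HasLaurent s (f + g) e (b + c) := by
  obtain ⟨P, rfl, hP⟩ := hf
  obtain ⟨Q, rfl, hQ⟩ := hg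
  exact ⟨P + Q, Polynomial.coeff_add P Q 0, by rw [map_add, ← hP, ← hQ]; ring⟩

theorem of_lt (hf : HasLaurent s f d c) (h : d < e) : HasLaurent s f e (0 : R) := by
  obtain ⟨P, -, hP⟩ := hf
  obtain ⟨k, rfl⟩ := Nat.exists_eq_add_of_lt h
  exact ⟨P * Polynomial.X ^ (k + 1), by
    rw [pow_succ, ← mul_assoc, Polynomial.coeff_mul_X_zero], by
    rw [map_mul, ← hP, map_pow, Polynomial.aeval_X]; ring⟩

theorem of_mul (hf : HasLaurent s (s * f) e c) : HasLaurent s f (e + 1) c := by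
  obtain ⟨P, rfl, hP⟩ := hf
  exact ⟨P, rfl, by rw [← hP]; ring⟩

theorem sum {ι : Type*} {I : Finset ι} {f : ι → A} {c : ι → R}
    (h : ∀ i ∈ I, HasLaurent s (f i) e (c i)) :
    HasLaurent s (∑ i ∈ I, f i) e (∑ i ∈ I, c i) := by
  choose! Q hQ hfQ using h
  exact ⟨∑ i ∈ I, Q i, by rw [Polynomial.finsetSum_coeff, Finset.sum_congr rfl hQ],
    by rw [map_sum, Finset.sum_mul, Finset.sum_congr rfl hfQ]⟩

end HasLaurent

end HasLaurent

theorem HasLaurent.eq_sum_rpowSeries {a c : ℝ} {f : ℝ⟦X⟧} {e : ℕ}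
    (h : HasLaurent (rpowSeries a (1 / 2)) f e c) : ∃ Q : Polynomial ℝ, Q.coeff 0 = c ∧
      f = ∑ i ∈ Finset.range (Q.natDegree + 1), Q.coeff i • rpowSeries a ((i - e) / 2) := by
  obtain ⟨Q, hQ, hf⟩ := h
  have hinv : rpowSeries a (1 / 2) ^ e * rpowSeries a (-e / 2) = 1 := by
    rw [rpowSeries_pow, ← rpowSeries_add, mul_one_div, neg_div, add_neg_cancel, rpowSeries_zero]
  refine ⟨Q, hQ, ?_⟩
  rw [← mul_one f, ← hinv, ← mul_assoc, hf, Polynomial.aeval_eq_sum_range, Finset.sum_mul]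
  refine Finset.sum_congr rfl fun i _ => ?_
  rw [smul_mul_assoc, rpowSeries_pow, ← rpowSeries_add, mul_one_div, ← add_div, ← sub_eq_add_neg]

theorem HasLaurent.tendsto_coeff {a c : ℝ} {f : ℝ⟦X⟧} {e : ℕ} (ha : a ≠ 0)
    (h : HasLaurent (rpowSeries a (1 / 2)) f e c) :
    Tendsto (fun n : ℕ => coeff n f / a ^ n * (n : ℝ) ^ (1 - e / 2 : ℝ)) atTop
      (𝓝 (c / Real.Gamma (e / 2))) := by
  obtain ⟨Q, rfl, rfl⟩ := h.eq_sum_rpowSeries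
  have hpow (i : ℕ) :
      Tendsto (fun n : ℕ => (n : ℝ) ^ (-(i / 2 : ℝ))) atTop (𝓝 (if i = 0 then 1 else 0)) := by
    split_ifs with hi
    · simp [hi]
    · exact (tendsto_rpow_neg_atTop (by positivity)).comp tendsto_natCast_atTop_atTop
  have hterm (i : ℕ) := ((tendsto_multichoose_mul_rpow ((e - i) / 2)).mul (hpow i)).const_mul
    (Q.coeff i)
  have hsum := tendsto_finsetSum (Finset.range (Q.natDegree + 1)) fun i _ => hterm i
  rw [Finset.sum_eq_single_of_mem 0 (Finset.mem_range.2 Q.natDegree.succ_pos)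
    fun i _ hi => by rw [if_neg hi, mul_zero, mul_zero], if_pos rfl, mul_one, Nat.cast_zero,
    sub_zero, ← div_eq_mul_inv] at hsum
  refine hsum.congr' ?_
  filter_upwards [eventually_gt_atTop 0] with n hn
  rw [map_sum, Finset.sum_div, Finset.sum_mul]
  refine Finset.sum_congr rfl fun i _ => ?_
  have hneg : (-((i - e) / 2) : ℝ) = (e - i) / 2 := by ring
  have hexp : (1 - e / 2 : ℝ) = 1 - (e - i) / 2 + -(i / 2) := by ring
  rw [map_smul, smul_eq_mul, coeff_rpowSeries, hneg, mul_div_assoc,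
    mul_div_cancel_left₀ _ (pow_ne_zero n ha), hexp, Real.rpow_add (Nat.cast_pos.2 hn), mul_assoc,
    mul_assoc]

end LaurentAsymptotics

namespace PlaneTree

/-! ### Copies of sets of addresses -/

/-- The possible positions of a node of a plane tree relative to another one. They encode the
ancestor order and the left-to-right order at once. -/
inductive RelPos
  | same | above | below | left | right

/-- The position of the second node relative to the first one, in terms of that of the first one
relative to the second one. -/
def RelPos.swap : RelPos → RelPos
  | .same => .same
  | .above => .below
  | .below => .above
  | .left => .right
  | .right => .left

/-- The position of the node with address `p` relative to the node with address `q`. -/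
def relPos : List ℕ → List ℕ → RelPos
  | [], [] => .same
  | [], _ :: _ => .above
  | _ :: _, [] => .below
  | i :: p, j :: q => if i < j then .left else if j < i then .right else relPos p q

theorem relPos_cons_cons_self (i : ℕ) (p q : List ℕ) : relPos (i :: p) (i :: q) = relPos p q := by
  simp [relPos]

theorem relPos_cons_cons_of_lt {i j : ℕ} (h : i < j) (p q : List ℕ) :
    relPos (i :: p) (j :: q) = .left := by
  simp [relPos, h]

theorem relPos_append_left (r p q : List ℕ) : relPos (r ++ p) (r ++ q) = relPos p q := by
  induction r with
  | nil => rfl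
  | cons i r ih => rw [List.cons_append, List.cons_append, relPos_cons_cons_self, ih]

theorem relPos_modifyHead_add (k : ℕ) (p q : List ℕ) :
    relPos (p.modifyHead (· + k)) (q.modifyHead (· + k)) = relPos p q := by
  cases p <;> cases q <;> simp [relPos]

theorem isPrefix_iff_relPos {p q : List ℕ} :
    p <+: q ↔ relPos p q = .same ∨ relPos p q = .above := by
  induction p generalizing q with
  | nil => cases q <;> simp [relPos]
  | cons i p ih =>
    cases q with
    | nil => simp [relPos]
    | cons j q =>
      rcases lt_trichotomy i j with h | rfl | h
      · simp [relPos, h, h.ne]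
      · simp [relPos, ih]
      · simp [relPos, h, h.ne', h.not_gt]

theorem relPos_eq_same_iff {p q : List ℕ} : relPos p q = .same ↔ p = q := by
  induction p generalizing q with
  | nil => cases q <;> simp [relPos]
  | cons i p ih =>
    cases q with
    | nil => simp [relPos]
    | cons j q =>
      rcases lt_trichotomy i j with h | rfl | h
      · simp [relPos, h, h.ne]
      · simp [relPos, ih]
      · simp [relPos, h, h.ne', h.not_gt]

theorem relPos_eq_left_iff {p q : List ℕ} : relPos p q = .left ↔
    ∃ (r : List ℕ) (i j : ℕ) (p' q' : List ℕ), i < j ∧ p = r ++ i :: p' ∧ q = r ++ j :: q' := by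
  constructor
  · intro h
    induction p generalizing q with
    | nil => cases q <;> simp [relPos] at h
    | cons i p ih =>
      cases q with
      | nil => simp [relPos] at h
      | cons j q =>
        rcases lt_trichotomy i j with hij | rfl | hij
        · exact ⟨[], i, j, p, q, hij, rfl, rfl⟩
        · obtain ⟨r, k, l, p', q', hkl, rfl, rfl⟩ := ih (relPos_cons_cons_self i p q ▸ h)
          exact ⟨i :: r, k, l, p', q', hkl, rfl, rfl⟩
        · simp [relPos, hij, hij.not_gt] at h
  · rintro ⟨r, i, j, p', q', hij, rfl, rfl⟩
    rw [relPos_append_left, relPos_cons_cons_of_lt hij]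

theorem relPos_swap (p q : List ℕ) : relPos q p = (relPos p q).swap := by
  induction p generalizing q with
  | nil => cases q <;> rfl
  | cons i p ih =>
    cases q with
    | nil => rfl
    | cons j q =>
      rcases lt_trichotomy i j with h | rfl | h
      · simp [relPos, RelPos.swap, h, h.not_gt]
      · simp [relPos, ih]
      · simp [relPos, RelPos.swap, h, h.not_gt]

/-- An isomorphism between two sets of addresses for the ancestor order and the left-to-right order,
given by a map that need only make sense on the first set. -/
def PosPreservingOn (φ : List ℕ → List ℕ) (A : Set (List ℕ)) : Prop :=
  ∀ u ∈ A, ∀ v ∈ A, relPos (φ u) (φ v) = relPos u v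

/-- The sets of addresses `A` and `X` are isomorphic for the ancestor order and the left-to-right
order. -/
def PlaneIso (A X : Set (List ℕ)) : Prop :=
  ∃ φ : List ℕ → List ℕ, PosPreservingOn φ A ∧ φ '' A = X

theorem PosPreservingOn.mono {φ : List ℕ → List ℕ} {A B : Set (List ℕ)} (h : PosPreservingOn φ B)
    (hAB : A ⊆ B) : PosPreservingOn φ A :=
  fun u hu v hv => h u (hAB hu) v (hAB hv)

theorem PosPreservingOn.injOn {φ : List ℕ → List ℕ} {A : Set (List ℕ)} (h : PosPreservingOn φ A) :
    Set.InjOn φ A := fun u hu v hv huv => by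
  rw [← relPos_eq_same_iff, ← h u hu v hv, relPos_eq_same_iff, huv]

theorem PosPreservingOn.planeIso_image {φ : List ℕ → List ℕ} {A : Set (List ℕ)}
    (h : PosPreservingOn φ A) : PlaneIso A (φ '' A) :=
  ⟨φ, h, rfl⟩

namespace PlaneIso

variable {A B C : Set (List ℕ)}

theorem refl (A : Set (List ℕ)) : PlaneIso A A :=
  ⟨id, fun _ _ _ _ => rfl, Set.image_id A⟩

theorem symm (h : PlaneIso A B) : PlaneIso B A := by
  obtain ⟨φ, hφ, rfl⟩ := h
  have hinv := hφ.injOn.leftInvOn_invFunOn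
  refine ⟨Function.invFunOn φ A, ?_, hinv.image_image⟩
  rintro _ ⟨u, hu, rfl⟩ _ ⟨v, hv, rfl⟩
  rw [hinv hu, hinv hv, hφ u hu v hv]

theorem trans (h : PlaneIso A B) (h' : PlaneIso B C) : PlaneIso A C := by
  obtain ⟨φ, hφ, rfl⟩ := h
  obtain ⟨ψ, hψ, rfl⟩ := h'
  refine ⟨ψ ∘ φ, fun u hu v hv => ?_, Set.image_comp ψ φ A⟩
  rw [Function.comp_apply, Function.comp_apply,
    hψ _ (Set.mem_image_of_mem φ hu) _ (Set.mem_image_of_mem φ hv), hφ u hu v hv]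

theorem ncard_eq (h : PlaneIso A B) : A.ncard = B.ncard := by
  obtain ⟨φ, hφ, rfl⟩ := h
  exact hφ.injOn.ncard_image.symm

end PlaneIso

/-- The subsets of `B` isomorphic to `A`. -/
def copies (A B : Set (List ℕ)) : Set (Set (List ℕ)) :=
  {X | X ⊆ B ∧ PlaneIso A X}

/-- The number of subsets of `B` isomorphic to `A`. It is meaningful for finite `B` only, since
`Set.ncard` of an infinite set is `0`. -/
noncomputable def numCopies (A B : Set (List ℕ)) : ℕ := (copies A B).ncard

theorem finite_copies (A : Set (List ℕ)) {B : Set (List ℕ)} (hB : B.Finite) : (copies A B).Finite :=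
  hB.finite_subsets.subset fun _ hX => hX.1

theorem copies_congr_left {A A' : Set (List ℕ)} (h : PlaneIso A A') (B : Set (List ℕ)) :
    copies A B = copies A' B :=
  Set.ext fun _ => and_congr_right fun _ => ⟨h.symm.trans, h.trans⟩

theorem copies_image {φ : List ℕ → List ℕ} {B : Set (List ℕ)} (hφ : PosPreservingOn φ B)
    (A : Set (List ℕ)) : copies A (φ '' B) = (φ '' ·) '' copies A B := by
  ext X
  constructor
  · rintro ⟨hXB, hAX⟩
    obtain ⟨Y, hY, rfl⟩ := Set.subset_image_iff.1 hXB
    exact ⟨Y, ⟨hY, hAX.trans (hφ.mono hY).planeIso_image.symm⟩, rfl⟩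
  · rintro ⟨Y, ⟨hY, hAY⟩, rfl⟩
    exact ⟨Set.image_mono hY, hAY.trans (hφ.mono hY).planeIso_image⟩

theorem numCopies_congr_right {B B' : Set (List ℕ)} (h : PlaneIso B B') (A : Set (List ℕ)) :
    numCopies A B' = numCopies A B := by
  obtain ⟨φ, hφ, rfl⟩ := h
  rw [numCopies, numCopies, copies_image hφ]
  exact Set.InjOn.ncard_image fun X hX Y hY => (hφ.injOn.image_eq_image_iff hX.1 hY.1).1

/-- Every element of `A` lies to the left of every element of `B`. -/
def Precedes (A B : Set (List ℕ)) : Prop :=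
  ∀ u ∈ A, ∀ v ∈ B, relPos u v = .left

namespace Precedes

variable {A₀ A₁ B₀ B₁ : Set (List ℕ)}

theorem mono (h : Precedes B₀ B₁) (h₀ : A₀ ⊆ B₀) (h₁ : A₁ ⊆ B₁) : Precedes A₀ A₁ :=
  fun u hu v hv => h u (h₀ hu) v (h₁ hv)

theorem disjoint (h : Precedes A₀ A₁) : Disjoint A₀ A₁ :=
  Set.disjoint_left.2 fun u hu hu' => by
    simpa only [relPos_eq_same_iff.2, reduceCtorEq] using h u hu u hu'

theorem planeIso_union (hA : Precedes A₀ A₁) (hB : Precedes B₀ B₁) (h₀ : PlaneIso A₀ B₀)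
    (h₁ : PlaneIso A₁ B₁) : PlaneIso (A₀ ∪ A₁) (B₀ ∪ B₁) := by
  classical
  obtain ⟨φ, hφ, rfl⟩ := h₀
  obtain ⟨ψ, hψ, rfl⟩ := h₁
  let χ := A₀.piecewise φ ψ
  have hχ₀ : Set.EqOn χ φ A₀ := Set.piecewise_eqOn ..
  have hχ₁ : Set.EqOn χ ψ A₁ :=
    (Set.piecewise_eqOn_compl ..).mono hA.disjoint.subset_compl_left
  have hleft : ∀ u ∈ A₀, ∀ v ∈ A₁, relPos (χ u) (χ v) = .left := fun u hu v hv => by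
    rw [hχ₀ hu, hχ₁ hv]
    exact hB _ (Set.mem_image_of_mem φ hu) _ (Set.mem_image_of_mem ψ hv)
  refine ⟨χ, ?_, by rw [Set.image_union, hχ₀.image_eq, hχ₁.image_eq]⟩
  rintro u (hu | hu) v (hv | hv)
  · rw [hχ₀ hu, hχ₀ hv, hφ u hu v hv]
  · rw [hleft u hu v hv, hA u hu v hv]
  · rw [relPos_swap (χ v), relPos_swap v, hleft v hv u hu, hA v hv u hu]
  · rw [hχ₁ hu, hχ₁ hv, hψ u hu v hv]

theorem exists_planeIso_of_union (hB : Precedes B₀ B₁) {A : Set (List ℕ)}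
    (h : PlaneIso A (B₀ ∪ B₁)) :
    ∃ A₀ A₁, A = A₀ ∪ A₁ ∧ Precedes A₀ A₁ ∧ PlaneIso A₀ B₀ ∧ PlaneIso A₁ B₁ := by
  obtain ⟨φ, hφ, himage⟩ := h
  have hrestrict : ∀ B ⊆ B₀ ∪ B₁, PlaneIso (A ∩ φ ⁻¹' B) B := fun B hB =>
    ⟨φ, hφ.mono Set.inter_subset_left, by
      rw [Set.image_inter_preimage, himage, Set.inter_eq_right.2 hB]⟩
  refine ⟨A ∩ φ ⁻¹' B₀, A ∩ φ ⁻¹' B₁, ?_, ?_, hrestrict B₀ Set.subset_union_left,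
    hrestrict B₁ Set.subset_union_right⟩
  · rw [← Set.inter_union_distrib_left, ← Set.preimage_union,
      Set.inter_eq_left.2 (Set.image_subset_iff.1 himage.subset)]
  · rintro u ⟨hu, hu₀⟩ v ⟨hv, hv₁⟩
    rw [← hφ u hu v hv]
    exact hB _ hu₀ _ hv₁

end Precedes

theorem relPos_eq_left_of_prefix {p q p' q' : List ℕ} (h : relPos p q = .left) (hp : p <+: p')
    (hq : q <+: q') : relPos p' q' = .left := by
  obtain ⟨r, i, j, p, q, hij, rfl, rfl⟩ := relPos_eq_left_iff.1 h
  obtain ⟨p', rfl⟩ := hp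
  obtain ⟨q', rfl⟩ := hq
  exact relPos_eq_left_iff.2 ⟨r, i, j, p ++ p', q ++ q', hij, by simp, by simp⟩

theorem relPos_eq_relPos {p q p' q' : List ℕ} (hpq : p' <+: q' ↔ p <+: q)
    (hqp : q' <+: p' ↔ q <+: p) (hleft : relPos p q = .left → relPos p' q' = .left)
    (hright : relPos q p = .left → relPos q' p' = .left) : relPos p' q' = relPos p q := by
  simp only [isPrefix_iff_relPos, relPos_swap p q, relPos_swap p' q'] at *
  generalize relPos p q = x at *
  generalize relPos p' q' = y at *
  cases x <;> cases y <;> simp_all [RelPos.swap]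

theorem isNode_nil (T : PlaneTree) : T.IsNode [] :=
  T.root.2

theorem IsNode.of_prefix {T : PlaneTree} {p q : List ℕ} (hq : T.IsNode q) (hpq : p <+: q) :
    T.IsNode p := by
  induction p generalizing T q with
  | nil => exact isNode_nil T
  | cons i p ih =>
    obtain ⟨r, rfl⟩ := hpq
    obtain ⟨ts⟩ := T
    obtain ⟨hi, hq⟩ := hq
    exact ⟨hi, ih hq (List.prefix_append p r)⟩

/-- The address of a node. -/
def Node.addr {T : PlaneTree} (u : T.Node) : List ℕ :=
  u.1

theorem Node.addr_injective {T : PlaneTree} : Function.Injective (Node.addr (T := T)) :=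
  Subtype.val_injective

theorem Node.ancestorEq_iff_relPos {T : PlaneTree} {u v : T.Node} :
    u.AncestorEq v ↔ relPos u.addr v.addr = .same ∨ relPos u.addr v.addr = .above :=
  isPrefix_iff_relPos

theorem Node.leftOf_iff_relPos {T : PlaneTree} {u v : T.Node} :
    u.LeftOf v ↔ relPos u.addr v.addr = .left :=
  relPos_eq_left_iff.symm

/-- The map `φ` need only respect the order of siblings: two nodes neither of which is an ancestor
of the other lie below two children of their meet. -/
theorem isPlaneEmbedding_iff_relPos {S T : PlaneTree} {φ : S.Node → T.Node} :
    IsPlaneEmbedding φ ↔ ∀ u v, relPos (φ u).addr (φ v).addr = relPos u.addr v.addr := by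
  refine ⟨fun hφ => ?_, fun h => ⟨fun u v => ?_, fun w u v _ _ huv => ?_⟩⟩
  · have hleft (u v) (huv : relPos u.addr v.addr = .left) :
        relPos (φ u).addr (φ v).addr = .left := by
      obtain ⟨r, i, j, p, q, hij, hu, hv⟩ := relPos_eq_left_iff.1 huv
      have hiu : r ++ [i] <+: u.addr := ⟨p, by simp [hu]⟩
      have hjv : r ++ [j] <+: v.addr := ⟨q, by simp [hv]⟩
      have hri : r <+: r ++ [i] := List.prefix_append r [i]
      let meet : S.Node := ⟨r, u.2.of_prefix (hri.trans hiu)⟩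
      let childU : S.Node := ⟨r ++ [i], u.2.of_prefix hiu⟩
      let childV : S.Node := ⟨r ++ [j], v.2.of_prefix hjv⟩
      have hchildren : (φ childU).LeftOf (φ childV) :=
        hφ.children_leftOf meet childU childV ⟨i, rfl⟩ ⟨j, rfl⟩ ⟨r, i, j, [], [], hij, rfl, rfl⟩
      exact relPos_eq_left_of_prefix (Node.leftOf_iff_relPos.1 hchildren)
        ((hφ.ancestorEq_iff childU u).2 hiu) ((hφ.ancestorEq_iff childV v).2 hjv)
    exact fun u v => relPos_eq_relPos (hφ.ancestorEq_iff u v) (hφ.ancestorEq_iff v u)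
      (hleft u v) (hleft v u)
  · rw [Node.ancestorEq_iff_relPos, Node.ancestorEq_iff_relPos, h]
  · rwa [Node.leftOf_iff_relPos, h, ← Node.leftOf_iff_relPos]

/-- The set of addresses of the nodes of `T`. -/
def addrs (T : PlaneTree) : Set (List ℕ) :=
  {p | T.IsNode p}

theorem finite_addrs (T : PlaneTree) : T.addrs.Finite :=
  Set.finite_coe_iff.1 (finite_node T)

theorem range_addr (T : PlaneTree) : Set.range (Node.addr (T := T)) = T.addrs :=
  Subtype.range_coe

theorem mem_embeddings_iff {S T : PlaneTree} {X : Set T.Node} :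
    X ∈ embeddings S T ↔ Node.addr '' X ∈ copies S.addrs T.addrs := by
  constructor
  · rintro ⟨φ, hφ, rfl⟩
    rw [isPlaneEmbedding_iff_relPos] at hφ
    let ψ : List ℕ → List ℕ := Function.extend Node.addr (fun u => (φ u).addr) id
    have hψ (u : S.Node) : ψ u.addr = (φ u).addr := Node.addr_injective.extend_apply _ _ u
    refine ⟨Set.image_subset_iff.2 fun u _ => u.2, ψ, fun u hu v hv => ?_, ?_⟩
    · exact (congrArg₂ relPos (hψ ⟨u, hu⟩) (hψ ⟨v, hv⟩)).trans (hφ ⟨u, hu⟩ ⟨v, hv⟩)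
    · rw [← range_addr, ← Set.range_comp, ← Set.range_comp]
      exact congrArg Set.range (funext hψ)
  · rintro ⟨-, ψ, hψ, himage⟩
    have hmem (u : S.Node) : T.IsNode (ψ u.addr) := by
      obtain ⟨v, -, hv⟩ := himage.subset (Set.mem_image_of_mem ψ u.2)
      exact hv ▸ v.2
    let φ (u : S.Node) : T.Node := ⟨ψ u.addr, hmem u⟩
    refine ⟨φ, isPlaneEmbedding_iff_relPos.2 fun u v => hψ u.addr u.2 v.addr v.2, ?_⟩
    rw [← Node.addr_injective.image_injective.eq_iff, ← himage, ← Set.range_comp,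
      ← range_addr, ← Set.range_comp]
    rfl

theorem image_addr_embeddings (S T : PlaneTree) :
    (Node.addr '' ·) '' embeddings S T = copies S.addrs T.addrs := by
  ext X
  refine ⟨?_, fun hX => ?_⟩
  · rintro ⟨Y, hY, rfl⟩
    exact mem_embeddings_iff.1 hY
  · obtain ⟨Y, rfl⟩ := Set.subset_range_iff_exists_image_eq.1 (hX.1.trans (range_addr T).superset)
    exact ⟨Y, mem_embeddings_iff.2 hX, rfl⟩

theorem image_addr_goodEmbeddings (S T : PlaneTree) :
    (Node.addr '' ·) '' goodEmbeddings S T = {X ∈ copies S.addrs T.addrs | [] ∈ X} := by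
  ext X
  rw [← image_addr_embeddings]
  constructor
  · rintro ⟨Y, ⟨hY, hroot⟩, rfl⟩
    exact ⟨⟨Y, hY, rfl⟩, T.root, hroot, rfl⟩
  · rintro ⟨⟨Y, hY, rfl⟩, u, hu, hroot⟩
    exact ⟨Y, ⟨hY, (Node.addr_injective hroot : u = T.root) ▸ hu⟩, rfl⟩

theorem numEmb_eq_numCopies (S T : PlaneTree) : numEmb S T = numCopies S.addrs T.addrs := by
  rw [numCopies, ← image_addr_embeddings]
  exact (Set.ncard_image_of_injective _ Node.addr_injective.image_injective).symm

theorem numGoodEmb_eq_ncard (S T : PlaneTree) :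
    numGoodEmb S T = {X ∈ copies S.addrs T.addrs | [] ∈ X}.ncard := by
  rw [← image_addr_goodEmbeddings]
  exact (Set.ncard_image_of_injective _ Node.addr_injective.image_injective).symm

/-! ### The recursion for forests -/

/-- The addresses of the nodes of an ordered forest, namely those of the tree obtained by joining
its trees to a new root, other than this root `[]`. -/
def forestNodes (σ : List PlaneTree) : Set (List ℕ) :=
  (node σ).addrs \ {[]}

theorem nil_notMem_forestNodes (σ : List PlaneTree) : [] ∉ forestNodes σ :=
  fun h => h.2 rfl

theorem cons_mem_forestNodes {σ : List PlaneTree} {i : ℕ} {p : List ℕ} :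
    i :: p ∈ forestNodes σ ↔ ∃ h : i < σ.length, σ[i].IsNode p :=
  and_iff_left (List.cons_ne_nil i p)

theorem finite_forestNodes (σ : List PlaneTree) : (forestNodes σ).Finite :=
  (finite_addrs _).sdiff

theorem insert_nil_forestNodes (ts : List PlaneTree) :
    insert [] (forestNodes ts) = (node ts).addrs := by
  rw [forestNodes, Set.insert_sdiff_singleton]
  exact Set.insert_eq_of_mem (isNode_nil (node ts))

theorem forestNodes_nil : forestNodes [] = ∅ := by
  ext (_ | ⟨i, p⟩)
  · simp [nil_notMem_forestNodes]
  · simp [cons_mem_forestNodes]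

theorem forestNodes_singleton (T : PlaneTree) : forestNodes [T] = List.cons 0 '' T.addrs := by
  ext (_ | ⟨i, p⟩)
  · simp [nil_notMem_forestNodes]
  · cases i <;> simp [cons_mem_forestNodes, addrs]

/-- The map on addresses that moves every node of a forest to the right by `k` trees. -/
def shift (k : ℕ) : List ℕ → List ℕ :=
  List.modifyHead (· + k)

theorem posPreservingOn_shift (k : ℕ) (A : Set (List ℕ)) : PosPreservingOn (shift k) A :=
  fun u _ v _ => relPos_modifyHead_add k u v

theorem nil_mem_shift_image {k : ℕ} {A : Set (List ℕ)} : [] ∈ shift k '' A ↔ [] ∈ A := by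
  simp [shift]

theorem cons_mem_shift_image {k i : ℕ} {p : List ℕ} {A : Set (List ℕ)} :
    i :: p ∈ shift k '' A ↔ k ≤ i ∧ (i - k) :: p ∈ A := by
  constructor
  · rintro ⟨_ | ⟨j, q⟩, hq, h⟩
    · simp [shift] at h
    · obtain ⟨rfl, rfl⟩ : j + k = i ∧ q = p := by simpa [shift] using h
      simpa using hq
  · rintro ⟨hk, h⟩
    exact ⟨_, h, by simp [shift, hk]⟩

theorem forestNodes_append (σ τ : List PlaneTree) :
    forestNodes (σ ++ τ) = forestNodes σ ∪ shift σ.length '' forestNodes τ := by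
  ext (_ | ⟨i, p⟩)
  · simp only [Set.mem_union, nil_mem_shift_image, nil_notMem_forestNodes, or_self]
  · simp only [Set.mem_union, cons_mem_shift_image, cons_mem_forestNodes, List.length_append]
    rcases lt_or_ge i σ.length with h | h
    · simp [h, h.not_ge, Nat.lt_add_right, List.getElem_append_left]
    · simp [h, h.not_gt, List.getElem_append_right, Nat.sub_lt_iff_lt_add' h]

theorem precedes_shift (σ τ : List PlaneTree) :
    Precedes (forestNodes σ) (shift σ.length '' forestNodes τ) := by
  rintro (_ | ⟨i, p⟩) hp (_ | ⟨j, q⟩) hq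
  · exact absurd hp (nil_notMem_forestNodes σ)
  · exact absurd hp (nil_notMem_forestNodes σ)
  · exact absurd (nil_mem_shift_image.1 hq) (nil_notMem_forestNodes τ)
  · exact relPos_cons_cons_of_lt
      ((cons_mem_forestNodes.1 hp).1.trans_le (cons_mem_shift_image.1 hq).1) p q

theorem forestNodes_take_union_drop (k : ℕ) (σ : List PlaneTree) :
    forestNodes (σ.take k) ∪ shift (σ.take k).length '' forestNodes (σ.drop k) = forestNodes σ := by
  rw [← forestNodes_append, List.take_append_drop]

theorem ncard_forestNodes_take_lt {σ : List PlaneTree} {k l : ℕ} (hkl : k < l)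
    (hl : l ≤ σ.length) : (forestNodes (σ.take k)).ncard < (forestNodes (σ.take l)).ncard := by
  refine Set.ncard_lt_ncard (Set.ssubset_iff_exists.2 ⟨?_, [k], ?_, ?_⟩) (finite_forestNodes _)
  · rw [← forestNodes_take_union_drop k (σ.take l), List.take_take, min_eq_left hkl.le]
    exact Set.subset_union_left
  · exact cons_mem_forestNodes.2 ⟨by simpa [hkl] using hkl.trans_le hl, isNode_nil _⟩
  · rw [cons_mem_forestNodes]
    simp

theorem exists_forestNodes_take_drop {σ : List PlaneTree} {A₀ A₁ : Set (List ℕ)}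
    (hσ : forestNodes σ = A₀ ∪ A₁) (hA : Precedes A₀ A₁) :
    ∃ k ≤ σ.length, A₀ = forestNodes (σ.take k) ∧
      A₁ = shift (σ.take k).length '' forestNodes (σ.drop k) := by
  classical
  obtain ⟨k, hk, hmin⟩ := Nat.findX (p := fun k => σ.length ≤ k ∨ [k] ∈ A₁) ⟨_, Or.inl le_rfl⟩
  have hkσ : k ≤ σ.length := le_of_not_gt fun h => hmin _ h (Or.inl le_rfl)
  have hbefore : forestNodes (σ.take k) ⊆ A₀ := by
    rintro (_ | ⟨i, p⟩) hp
    · exact absurd hp (nil_notMem_forestNodes _)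
    have hik : i < k := (lt_min_iff.1 (List.length_take ▸ (cons_mem_forestNodes.1 hp).1)).1
    have hpσ := (forestNodes_take_union_drop k σ).subset (Or.inl hp)
    have hi : [i] ∈ A₀ ∪ A₁ :=
      hσ.subset (cons_mem_forestNodes.2 ⟨(cons_mem_forestNodes.1 hpσ).1, isNode_nil _⟩)
    refine (hσ.subset hpσ).resolve_right fun hp₁ => ?_
    have hleft := hA _ (hi.resolve_right fun h => hmin i hik (Or.inr h)) _ hp₁
    rw [relPos_cons_cons_self] at hleft
    cases p <;> simp [relPos] at hleft
  have hafter : shift (σ.take k).length '' forestNodes (σ.drop k) ⊆ A₁ := by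
    rintro (_ | ⟨i, p⟩) hp
    · exact absurd (nil_mem_shift_image.1 hp) (nil_notMem_forestNodes _)
    have hki : k ≤ i := by simpa [hkσ] using (cons_mem_shift_image.1 hp).1
    have hpσ := (forestNodes_take_union_drop k σ).subset (Or.inr hp)
    have hk₁ : [k] ∈ A₁ := hk.resolve_left (hki.trans_lt (cons_mem_forestNodes.1 hpσ).1).not_ge
    refine (hσ.subset hpσ).resolve_left fun hp₀ => ?_
    have hleft := hA _ hp₀ _ hk₁
    rcases hki.eq_or_lt with rfl | hki
    · cases p <;> simp [relPos] at hleft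
    · simp [relPos, hki, hki.not_gt] at hleft
  have hunion := hσ.symm.trans (forestNodes_take_union_drop k σ).symm
  have hdisj := Set.disjoint_left.1 hA.disjoint
  exact ⟨k, hkσ,
    Set.Subset.antisymm
      (fun u hu => (hunion.subset (Or.inl hu)).resolve_right fun h => hdisj hu (hafter h)) hbefore,
    Set.Subset.antisymm
      (fun u hu => (hunion.subset (Or.inr hu)).resolve_left fun h => hdisj (hbefore h) hu) hafter⟩

theorem copies_forestNodes_union {B₀ B₁ : Set (List ℕ)} (hB : Precedes B₀ B₁)
    (σ : List PlaneTree) :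
    copies (forestNodes σ) (B₀ ∪ B₁) = (fun X : Set (List ℕ) × Set (List ℕ) => X.1 ∪ X.2) ''
      ⋃ k ∈ (Finset.range (σ.length + 1) : Set ℕ),
        copies (forestNodes (σ.take k)) B₀ ×ˢ copies (forestNodes (σ.drop k)) B₁ := by
  ext X
  simp only [Finset.coe_range, Set.mem_Iio, Nat.lt_succ_iff, Set.mem_image, Set.mem_iUnion,
    exists_prop]
  constructor
  · rintro ⟨hXB, hX⟩
    obtain ⟨X₀, X₁, rfl, h₀, h₁⟩ : ∃ X₀ X₁, X₀ ∪ X₁ = X ∧ X₀ ⊆ B₀ ∧ X₁ ⊆ B₁ :=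
      ⟨X ∩ B₀, X ∩ B₁, by rw [← Set.inter_union_distrib_left, Set.inter_eq_left.2 hXB],
        Set.inter_subset_right, Set.inter_subset_right⟩
    obtain ⟨A₀, A₁, hσ, hA, hA₀, hA₁⟩ := (hB.mono h₀ h₁).exists_planeIso_of_union hX
    obtain ⟨k, hk, rfl, rfl⟩ := exists_forestNodes_take_drop hσ hA
    exact ⟨(X₀, X₁), ⟨k, hk, ⟨h₀, hA₀⟩, h₁,
      (posPreservingOn_shift _ _).planeIso_image.trans hA₁⟩, rfl⟩
  · rintro ⟨⟨X₀, X₁⟩, ⟨k, -, ⟨h₀, hX₀⟩, h₁, hX₁⟩, rfl⟩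
    refine ⟨Set.union_subset_union h₀ h₁, ?_⟩
    rw [← forestNodes_take_union_drop k σ]
    exact (precedes_shift _ _).planeIso_union (hB.mono h₀ h₁) hX₀
      ((posPreservingOn_shift _ _).planeIso_image.symm.trans hX₁)

theorem disjoint_copies_take {σ : List PlaneTree} {k l : ℕ} (hk : k ≤ σ.length)
    (hl : l ≤ σ.length) (hkl : k ≠ l) (B : Set (List ℕ)) :
    Disjoint (copies (forestNodes (σ.take k)) B) (copies (forestNodes (σ.take l)) B) := by
  refine Set.disjoint_left.2 fun X hX hX' => ?_
  have hcard := hX.2.ncard_eq.trans hX'.2.ncard_eq.symm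
  rcases hkl.lt_or_gt with h | h
  · exact (ncard_forestNodes_take_lt h hl).ne hcard
  · exact (ncard_forestNodes_take_lt h hk).ne' hcard

theorem numCopies_forestNodes_union {B₀ B₁ : Set (List ℕ)} (hB : Precedes B₀ B₁) (h₀ : B₀.Finite)
    (h₁ : B₁.Finite) (σ : List PlaneTree) :
    numCopies (forestNodes σ) (B₀ ∪ B₁) = ∑ k ∈ Finset.range (σ.length + 1),
      numCopies (forestNodes (σ.take k)) B₀ * numCopies (forestNodes (σ.drop k)) B₁ := by
  rw [numCopies, copies_forestNodes_union hB,
    ((injOn_union_of_disjoint hB.disjoint).mono ?_).ncard_image,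
    Set.Finite.ncard_biUnion (Finset.finite_toSet _)
      (fun k _ => (finite_copies _ h₀).prod (finite_copies _ h₁)), finsum_mem_coe_finset]
  · exact Finset.sum_congr rfl fun k _ => Set.ncard_prod
  · intro k hk l hl hkl
    rw [Finset.coe_range, Set.mem_Iio, Nat.lt_succ_iff] at hk hl
    exact Set.disjoint_prod.2 (Or.inl (disjoint_copies_take hk hl hkl B₀))
  · exact Set.iUnion₂_subset fun k _ X hX => ⟨hX.1.1, hX.2.1⟩

theorem relPos_nil_left {q : List ℕ} (hq : q ≠ []) : relPos [] q = .above := by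
  cases q <;> trivial

theorem PlaneIso.insert_nil {A Y : Set (List ℕ)} (hA : [] ∉ A) (hY : [] ∉ Y) (h : PlaneIso A Y) :
    PlaneIso (insert [] A) (insert [] Y) := by
  obtain ⟨φ, hφ, rfl⟩ := h
  have hupdate : Set.EqOn (Function.update φ [] []) φ A := fun u hu =>
    Function.update_of_ne (ne_of_mem_of_not_mem hu hA) [] φ
  have hroot (v) (hv : v ∈ A) : relPos [] (φ v) = relPos [] v := by
    rw [relPos_nil_left (ne_of_mem_of_not_mem hv hA),
      relPos_nil_left (ne_of_mem_of_not_mem (Set.mem_image_of_mem φ hv) hY)]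
  refine ⟨Function.update φ [] [], ?_, ?_⟩
  · rintro u (rfl | hu) v (rfl | hv)
    · rw [Function.update_self]
    · rw [Function.update_self, hupdate hv, hroot v hv]
    · rw [Function.update_self, hupdate hu, relPos_swap [] (φ u), hroot u hu, ← relPos_swap]
    · rw [hupdate hu, hupdate hv, hφ u hu v hv]
  · rw [Set.image_insert_eq, Function.update_self, hupdate.image_eq]

theorem PlaneIso.of_insert_nil {A Y : Set (List ℕ)} (hA : [] ∉ A) (hY : [] ∉ Y)
    (h : PlaneIso (insert [] A) (insert [] Y)) : PlaneIso A Y := by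
  obtain ⟨φ, hφ, himage⟩ := h
  have hnil : [] ∈ insert [] A := Set.mem_insert [] A
  have hφnil : φ [] = [] := by
    obtain ⟨u, hu, hφu⟩ := himage.superset (Set.mem_insert [] Y)
    by_contra hne
    have habove := hφ u hu [] hnil
    rw [hφu, relPos_nil_left hne] at habove
    cases u <;> simp [relPos] at habove
  have hnotMem : [] ∉ φ '' A := by
    rintro ⟨u, hu, hφu⟩
    exact hA (hφ.injOn hnil (Set.mem_insert_of_mem [] hu) (hφnil.trans hφu.symm) ▸ hu)
  refine ⟨φ, hφ.mono (Set.subset_insert [] A), ?_⟩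
  rw [Set.image_insert_eq, hφnil] at himage
  exact Set.insert_erase_invOn.2.injOn hnotMem hY himage

theorem ncard_rooted_copies_insert_nil {A B : Set (List ℕ)} (hA : [] ∉ A) (hB : [] ∉ B) :
    {X ∈ copies (insert [] A) (insert [] B) | [] ∈ X}.ncard = numCopies A B := by
  have heq : {X ∈ copies (insert [] A) (insert [] B) | [] ∈ X} = insert [] '' copies A B := by
    ext X
    constructor
    · rintro ⟨⟨hXB, hX⟩, hnil⟩
      have hnotMem : [] ∉ X \ {[]} := fun h => h.2 rfl
      rw [← Set.insert_sdiff_self_of_mem hnil] at hX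
      exact ⟨X \ {[]}, ⟨Set.sdiff_singleton_subset_iff.2 hXB, hX.of_insert_nil hA hnotMem⟩,
        Set.insert_sdiff_self_of_mem hnil⟩
    · rintro ⟨Y, ⟨hYB, hY⟩, rfl⟩
      exact ⟨⟨Set.insert_subset_insert hYB, hY.insert_nil hA fun h => hB (hYB h)⟩,
        Set.mem_insert [] Y⟩
  rw [heq, numCopies, Set.InjOn.ncard_image]
  exact Set.insert_erase_invOn.2.injOn.mono fun X hX h => hB (hX.1 h)

theorem numCopies_insert_nil (A : Set (List ℕ)) {B : Set (List ℕ)} (hB : [] ∉ B)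
    (hfin : B.Finite) : numCopies A (insert [] B) =
      numCopies A B + {X ∈ copies A (insert [] B) | [] ∈ X}.ncard := by
  have hunion : copies A (insert [] B) = copies A B ∪ {X ∈ copies A (insert [] B) | [] ∈ X} := by
    ext X
    constructor
    · intro hX
      by_cases hnil : [] ∈ X
      · exact Or.inr ⟨hX, hnil⟩
      · exact Or.inl ⟨(Set.subset_insert_iff_of_notMem hnil).1 hX.1, hX.2⟩
    · rintro (hX | hX)
      · exact ⟨hX.1.trans (Set.subset_insert [] B), hX.2⟩
      · exact hX.1
  have hdisj : Disjoint (copies A B) {X ∈ copies A (insert [] B) | [] ∈ X} :=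
    Set.disjoint_left.2 fun X hX hX' => hB (hX.1 hX'.2)
  exact (congrArg Set.ncard hunion).trans (Set.ncard_union_eq hdisj (finite_copies A hfin)
    ((finite_copies A (hfin.insert [])).subset (Set.sep_subset _ _)))

theorem length_eq_one_of_rooted_copy {σ : List PlaneTree} {B X : Set (List ℕ)}
    (hX : X ∈ copies (forestNodes σ) B) (hnil : [] ∈ X) : σ.length = 1 := by
  obtain ⟨-, φ, hφ, rfl⟩ := hX
  obtain ⟨_ | ⟨i, p⟩, hp, hφp⟩ := hnil
  · exact absurd hp (nil_notMem_forestNodes σ)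
  have hfirst (j) (hj : j < σ.length) : i = j := by
    have hmem : [j] ∈ forestNodes σ := cons_mem_forestNodes.2 ⟨hj, isNode_nil _⟩
    have hprefix : i :: p <+: [j] := by
      rw [isPrefix_iff_relPos, ← hφ _ hp _ hmem, hφp, ← isPrefix_iff_relPos]
      exact List.nil_prefix
    exact (List.cons_prefix_cons.1 hprefix).1
  have hi := (cons_mem_forestNodes.1 hp).1
  by_contra hne
  have h₀ := hfirst 0 (by omega)
  have h₁ := hfirst 1 (by omega)
  omega

/-- The number of copies of the forest `σ` in the forest `τ`. -/
noncomputable def forestCount (σ τ : List PlaneTree) : ℕ :=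
  numCopies (forestNodes σ) (forestNodes τ)

theorem planeIso_forestNodes_singleton (T : PlaneTree) : PlaneIso T.addrs (forestNodes [T]) := by
  rw [forestNodes_singleton]
  exact PosPreservingOn.planeIso_image fun u _ v _ => relPos_cons_cons_self 0 u v

theorem forestCount_singleton_right (σ ts : List PlaneTree) :
    forestCount σ [node ts] = numCopies (forestNodes σ) (insert [] (forestNodes ts)) := by
  rw [forestCount, numCopies_congr_right (planeIso_forestNodes_singleton _), insert_nil_forestNodes]

theorem forestCount_singleton_singleton (ss ts : List PlaneTree) :
    forestCount [node ss] [node ts] = forestCount [node ss] ts + forestCount ss ts := by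
  rw [forestCount_singleton_right,
    numCopies_insert_nil _ (nil_notMem_forestNodes ts) (finite_forestNodes ts),
    copies_congr_left (planeIso_forestNodes_singleton (node ss)).symm,
    ← insert_nil_forestNodes, ncard_rooted_copies_insert_nil (nil_notMem_forestNodes ss)
      (nil_notMem_forestNodes ts), forestCount, forestCount]

theorem forestCount_singleton_right_of_length_ne_one {σ : List PlaneTree} (hσ : σ.length ≠ 1)
    (ts : List PlaneTree) : forestCount σ [node ts] = forestCount σ ts := by
  have hempty : {X ∈ copies (forestNodes σ) (insert [] (forestNodes ts)) | [] ∈ X} = ∅ :=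
    Set.eq_empty_of_forall_notMem fun X hX => hσ (length_eq_one_of_rooted_copy hX.1 hX.2)
  rw [forestCount_singleton_right,
    numCopies_insert_nil _ (nil_notMem_forestNodes ts) (finite_forestNodes ts), hempty,
    Set.ncard_empty, add_zero, forestCount]

theorem forestCount_cons (σ τ : List PlaneTree) (t : PlaneTree) :
    forestCount σ (t :: τ) = ∑ k ∈ Finset.range (σ.length + 1),
      forestCount (σ.take k) [t] * forestCount (σ.drop k) τ := by
  rw [forestCount, ← List.singleton_append, forestNodes_append,
    numCopies_forestNodes_union (precedes_shift [t] τ) (finite_forestNodes [t])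
      ((finite_forestNodes τ).image _)]
  refine Finset.sum_congr rfl fun k _ => ?_
  rw [numCopies_congr_right (posPreservingOn_shift _ _).planeIso_image]
  rfl

theorem forestCount_nil_left (τ : List PlaneTree) : forestCount [] τ = 1 := by
  have hcopies : copies ∅ (forestNodes τ) = {∅} := by
    ext X
    refine ⟨fun hX => ?_, ?_⟩
    · obtain ⟨φ, -, hφ⟩ := hX.2
      exact hφ.symm.trans (Set.image_empty φ)
    · rintro rfl
      exact ⟨Set.empty_subset _, PlaneIso.refl ∅⟩
  rw [forestCount, forestNodes_nil, numCopies, hcopies, Set.ncard_singleton]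

theorem forestCount_cons_nil (s : PlaneTree) (σ : List PlaneTree) :
    forestCount (s :: σ) [] = 0 := by
  have hcopies : copies (forestNodes (s :: σ)) ∅ = ∅ := by
    refine Set.eq_empty_of_forall_notMem ?_
    rintro X ⟨hX, φ, -, rfl⟩
    exact hX (Set.mem_image_of_mem φ
      (cons_mem_forestNodes.2 ⟨Nat.succ_pos σ.length, isNode_nil _⟩ : [0] ∈ forestNodes (s :: σ)))
  rw [forestCount, forestNodes_nil, numCopies, hcopies, Set.ncard_empty]

theorem numEmb_eq_forestCount (S T : PlaneTree) : numEmb S T = forestCount [S] [T] := by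
  rw [numEmb_eq_numCopies, forestCount, numCopies_congr_right (planeIso_forestNodes_singleton T),
    numCopies, copies_congr_left (planeIso_forestNodes_singleton S), ← numCopies]

theorem numGoodEmb_node_node (ss ts : List PlaneTree) :
    numGoodEmb (node ss) (node ts) = forestCount ss ts := by
  rw [numGoodEmb_eq_ncard, ← insert_nil_forestNodes, ← insert_nil_forestNodes,
    ncard_rooted_copies_insert_nil (nil_notMem_forestNodes ss) (nil_notMem_forestNodes ts),
    forestCount]

theorem forest_induction {P : List PlaneTree → Prop} (nil : P [])
    (cons : ∀ ss τ, P ss → P τ → P (node ss :: τ)) : ∀ σ, P σ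
  | [] => nil
  | node ss :: τ => cons ss τ (forest_induction nil cons ss) (forest_induction nil cons τ)

/-- The number of nodes plus the number of leaves of a forest. -/
def weight (σ : List PlaneTree) : ℕ :=
  (σ.map fun s => s.size + s.leaves).sum

theorem weight_cons (s : PlaneTree) (σ : List PlaneTree) :
    weight (s :: σ) = weight [s] + weight σ := by
  simp [weight]

theorem weight_take_add_weight_drop (k : ℕ) (σ : List PlaneTree) :
    weight (σ.take k) + weight (σ.drop k) = weight σ := by
  rw [weight, weight, weight, ← List.sum_append, ← List.map_append, List.take_append_drop]

theorem leaves_pos : ∀ T : PlaneTree, 0 < T.leaves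
  | node [] => by simp [leaves]
  | node (t :: ts) => by
    rw [leaves]
    exact Nat.add_pos_left t.leaves_pos _

theorem weight_singleton (ss : List PlaneTree) : weight [node ss] = max (weight ss + 1) 2 := by
  cases ss with
  | nil => simp [weight, size, leaves]
  | cons s ss =>
    have hsize := s.size_pos
    have hleaves := s.leaves_pos
    simp only [weight, size, leaves, List.map_cons, List.sum_cons, List.sum_map_add, List.map_nil,
      List.sum_nil]
    omega

theorem weight_le_of_forestCount_ne_zero {σ τ : List PlaneTree} (h : forestCount σ τ ≠ 0) :
    weight σ ≤ weight τ := by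
  induction τ using forest_induction generalizing σ with
  | nil =>
    cases σ with
    | nil => exact le_rfl
    | cons s σ => exact absurd (forestCount_cons_nil s σ) h
  | cons ts τ hts hτ =>
    have hroot {ρ} (hρ : forestCount ρ [node ts] ≠ 0) : weight ρ ≤ weight [node ts] := by
      rw [weight_singleton]
      by_cases hlen : ρ.length = 1
      · obtain ⟨⟨ss⟩, rfl⟩ := List.length_eq_one_iff.1 hlen
        rw [forestCount_singleton_singleton, ← Nat.pos_iff_ne_zero, Nat.add_pos_iff_pos_or_pos,
          Nat.pos_iff_ne_zero, Nat.pos_iff_ne_zero] at hρ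
        rcases hρ with hρ | hρ
        · have := hts hρ
          omega
        · have := hts hρ
          rw [weight_singleton]
          omega
      · rw [forestCount_singleton_right_of_length_ne_one hlen] at hρ
        have := hts hρ
        omega
    rw [forestCount_cons] at h
    obtain ⟨k, -, hk⟩ := Finset.exists_ne_zero_of_sum_ne_zero h
    rw [← weight_take_add_weight_drop k σ, weight_cons]
    exact Nat.add_le_add (hroot (left_ne_zero_of_mul hk)) (hτ (right_ne_zero_of_mul hk))

theorem Embeds.size_add_leaves_le {S T : PlaneTree} (h : S.Embeds T) :
    S.size + S.leaves ≤ T.size + T.leaves := by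
  have hcount : forestCount [S] [T] ≠ 0 := by
    rw [← numEmb_eq_forestCount]
    exact Set.ncard_ne_zero_of_mem h.some_mem
  simpa [weight] using weight_le_of_forestCount_ne_zero hcount

/-! ### Generating functions -/

theorem mem_family {n : ℕ} {T : PlaneTree} : T ∈ family n ↔ T.size = n :=
  Set.Finite.mem_toFinset _

/-- The forest of the subtrees attached to the root of a tree. -/
def children : PlaneTree → List PlaneTree
  | node ts => ts

/-- The tree obtained from `T` by attaching `t` to its root as a new leftmost subtree. -/
def graft (t T : PlaneTree) : PlaneTree :=
  node (t :: T.children)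

theorem size_graft (t T : PlaneTree) : (graft t T).size = t.size + T.size := by
  cases T
  simp only [graft, children, size, List.map_cons, List.sum_cons]
  omega

theorem graft_injective : Function.Injective2 graft := by
  rintro t t' ⟨ts⟩ ⟨ts'⟩ h
  simpa [graft, children] using h

open Finset.HasAntidiagonal

theorem sum_family {R : Type*} [AddCommMonoid R] (w : PlaneTree → R) (n : ℕ) :
    ∑ T ∈ family n, w T = (if n = 1 then w (node []) else 0) +
      ∑ p ∈ antidiagonal n, ∑ t ∈ family p.1, ∑ T ∈ family p.2, w (graft t T) := by
  have := Classical.decEq PlaneTree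
  have hleaf : ∑ T ∈ family n with T = node [], w T = if n = 1 then w (node []) else 0 := by
    rw [Finset.filter_eq', apply_ite (fun s => ∑ T ∈ s, w T), Finset.sum_singleton,
      Finset.sum_empty]
    simp [mem_family, size, eq_comm]
  rw [← Finset.sum_filter_add_sum_filter_not (family n) (· = node []), hleaf]
  congr 1
  simp_rw [← Finset.sum_product', Finset.sum_sigma']
  symm
  refine Finset.sum_nbij (fun x => graft x.2.1 x.2.2) ?_ ?_ ?_ fun _ _ => rfl
  · rintro ⟨⟨a, b⟩, t, T⟩ h
    simp only [Finset.mem_sigma, mem_antidiagonal, Finset.mem_product, mem_family] at h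
    obtain ⟨hn, rfl, rfl⟩ := h
    exact Finset.mem_coe.2 (Finset.mem_filter.2
      ⟨mem_family.2 ((size_graft t T).trans hn), by simp [graft]⟩)
  · rintro ⟨⟨a, b⟩, t, T⟩ h ⟨⟨a', b'⟩, t', T'⟩ h' heq
    simp only [Finset.mem_coe, Finset.mem_sigma, mem_antidiagonal, Finset.mem_product,
      mem_family] at h h'
    obtain ⟨rfl, rfl⟩ := graft_injective heq
    obtain ⟨-, rfl, rfl⟩ := h
    obtain ⟨-, rfl, rfl⟩ := h'
    rfl
  · rintro ⟨_ | ⟨t, ts⟩⟩ h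
    · simp at h
    · have hsize : t.size + (node ts).size = n := by
        rw [← size_graft]
        exact mem_family.1 (Finset.mem_filter.1 h).1
      exact ⟨⟨(t.size, (node ts).size), t, node ts⟩, by simp [mem_family, hsize], rfl⟩

open PowerSeries

section genFun

variable {R : Type*} [CommSemiring R]

/-- The generating function of planted plane trees by number of nodes, with weights `w`. -/
noncomputable def genFun (w : PlaneTree → R) : R⟦X⟧ :=
  mk fun n => ∑ T ∈ family n, w T

theorem coeff_genFun (w : PlaneTree → R) (n : ℕ) : coeff n (genFun w) = ∑ T ∈ family n, w T :=
  coeff_mk n _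

theorem genFun_add (v w : PlaneTree → R) : genFun (fun T => v T + w T) = genFun v + genFun w := by
  ext n
  simp only [coeff_genFun, map_add, Finset.sum_add_distrib]

theorem genFun_eq_of_graft {ι : Type*} {w : PlaneTree → R} {I : Finset ι} {u v : ι → PlaneTree → R}
    (h : ∀ t T, w (graft t T) = ∑ i ∈ I, u i t * v i T) :
    genFun w = C (w (node [])) * X + ∑ i ∈ I, genFun (u i) * genFun (v i) := by
  ext n
  rw [coeff_genFun, sum_family, map_add, coeff_C_mul, coeff_X, mul_ite, mul_one, mul_zero]
  congr 1
  simp only [h, map_sum, coeff_mul, coeff_genFun, Finset.sum_mul_sum]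
  rw [Finset.sum_comm (s := I)]
  refine Finset.sum_congr rfl fun p _ => ?_
  rw [Finset.sum_comm (s := I)]
  exact Finset.sum_congr rfl fun t _ => Finset.sum_comm

end genFun

/-- The generating function of the embeddings of `σ` into the forest of the subtrees attached to
the root of a tree. -/
noncomputable def forestSeries (σ : List PlaneTree) : ℝ⟦X⟧ :=
  genFun fun T => (forestCount σ T.children : ℝ)

/-- The generating function of the embeddings of `σ` into a tree. -/
noncomputable def embSeries (σ : List PlaneTree) : ℝ⟦X⟧ :=
  genFun fun T => (forestCount σ [T] : ℝ)

/-- The generating function of planted plane trees. -/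
noncomputable def treeSeries : ℝ⟦X⟧ :=
  genFun fun _ => 1

/-- The power series `√(1 - 4X)`. -/
noncomputable def sqrtSeries : ℝ⟦X⟧ :=
  rpowSeries 4 (1 / 2)

theorem treeSeries_eq : treeSeries = X + treeSeries * treeSeries := by
  simpa [treeSeries] using genFun_eq_of_graft (R := ℝ) (w := fun _ => 1) (I := {()})
    (u := fun _ _ => 1) (v := fun _ _ => 1) fun _ _ => by simp

theorem constantCoeff_treeSeries : constantCoeff treeSeries = 0 := by
  have hfamily : family 0 = ∅ :=
    Finset.eq_empty_of_forall_notMem fun T hT => T.size_pos.ne' (mem_family.1 hT)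
  rw [treeSeries, ← coeff_zero_eq_constantCoeff_apply, coeff_genFun, hfamily, Finset.sum_empty]

theorem sqrtSeries_eq : sqrtSeries = 1 - 2 * treeSeries := by
  have hsq : sqrtSeries ^ 2 = (1 - 2 * treeSeries) ^ 2 := by
    have h := rpowSeries_one 4
    rw [map_ofNat] at h
    rw [sqrtSeries, rpowSeries_pow, Nat.cast_ofNat, mul_one_div_cancel two_ne_zero, h]
    linear_combination 4 * treeSeries_eq
  refine (sq_eq_sq_iff_eq_or_eq_neg.1 hsq).resolve_right fun hneg => ?_
  have hconst := congrArg constantCoeff hneg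
  rw [sqrtSeries, constantCoeff_rpowSeries, map_neg, map_sub, map_mul, constantCoeff_treeSeries,
    map_one, mul_zero, sub_zero] at hconst
  norm_num at hconst

theorem forestSeries_nil : forestSeries [] = treeSeries := by
  simp only [forestSeries, treeSeries, forestCount_nil_left, Nat.cast_one]

theorem embSeries_of_length_ne_one {σ : List PlaneTree} (hσ : σ.length ≠ 1) :
    embSeries σ = forestSeries σ :=
  congrArg genFun <| funext fun ⟨ts⟩ =>
    congrArg Nat.cast (forestCount_singleton_right_of_length_ne_one hσ ts)

theorem embSeries_singleton (ss : List PlaneTree) :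
    embSeries [node ss] = forestSeries [node ss] + forestSeries ss := by
  rw [forestSeries, forestSeries, ← genFun_add]
  refine congrArg genFun (funext fun ⟨ts⟩ => ?_)
  rw [forestCount_singleton_singleton, Nat.cast_add]
  rfl

theorem embSeries_cons (ss σ : List PlaneTree) : embSeries (node ss :: σ) =
    forestSeries (node ss :: σ) + if σ = [] then forestSeries ss else 0 := by
  cases σ with
  | nil => rw [embSeries_singleton, if_pos rfl]
  | cons s σ =>
    rw [embSeries_of_length_ne_one (by simp), if_neg (List.cons_ne_nil s σ), add_zero]

theorem forestSeries_cons_eq_sum (s : PlaneTree) (σ : List PlaneTree) :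
    forestSeries (s :: σ) = ∑ k ∈ Finset.range (σ.length + 1),
      embSeries (s :: σ.take k) * forestSeries (σ.drop k) + treeSeries * forestSeries (s :: σ) := by
  have hgraft (t T : PlaneTree) : (forestCount (s :: σ) (graft t T).children : ℝ) =
      ∑ k ∈ Finset.range ((s :: σ).length + 1),
        (forestCount ((s :: σ).take k) [t] : ℝ) * forestCount ((s :: σ).drop k) T.children := by
    rw [graft, children, forestCount_cons]
    push_cast
    rfl
  have hsum : forestSeries (s :: σ) = C (forestCount (s :: σ) [] : ℝ) * X +
      ∑ k ∈ Finset.range ((s :: σ).length + 1),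
        embSeries ((s :: σ).take k) * forestSeries ((s :: σ).drop k) :=
    genFun_eq_of_graft (w := fun T => (forestCount (s :: σ) T.children : ℝ))
      (u := fun k t => (forestCount ((s :: σ).take k) [t] : ℝ))
      (v := fun k T => (forestCount ((s :: σ).drop k) T.children : ℝ)) hgraft
  rw [forestCount_cons_nil, Nat.cast_zero, map_zero, zero_mul, zero_add, List.length_cons,
    Finset.sum_range_succ', List.take_zero, List.drop_zero,
    embSeries_of_length_ne_one (by simp), forestSeries_nil] at hsum
  exact hsum

theorem sqrtSeries_mul_forestSeries (ss σ : List PlaneTree) :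
    sqrtSeries * forestSeries (node ss :: σ) = forestSeries ss * forestSeries σ +
      ∑ k ∈ Finset.range σ.length,
        forestSeries (node ss :: σ.take k) * forestSeries (σ.drop k) := by
  have hroot : ∑ k ∈ Finset.range (σ.length + 1),
      (if σ.take k = [] then forestSeries ss else 0) * forestSeries (σ.drop k) =
        forestSeries ss * forestSeries σ := by
    rw [Finset.sum_range_succ', Finset.sum_eq_zero, zero_add, List.take_zero, List.drop_zero,
      if_pos rfl]
    intro k hk
    have hne : σ.take (k + 1) ≠ [] := by
      rw [← List.length_pos_iff, List.length_take]
      have := Finset.mem_range.1 hk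
      omega
    rw [if_neg hne, zero_mul]
  have hsum := forestSeries_cons_eq_sum (node ss) σ
  simp only [embSeries_cons, add_mul, Finset.sum_add_distrib, hroot] at hsum
  rw [Finset.sum_range_succ, List.take_length, List.drop_length, forestSeries_nil] at hsum
  rw [sqrtSeries_eq]
  linear_combination hsum

theorem hasLaurent_treeSeries : HasLaurent sqrtSeries treeSeries 0 (1 / 2 : ℝ) := by
  refine ⟨Polynomial.C (1 / 2) * (1 - Polynomial.X), by simp, ?_⟩
  have hhalf : algebraMap ℝ ℝ⟦X⟧ (1 / 2) * 2 = 1 := by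
    rw [← map_ofNat (algebraMap ℝ ℝ⟦X⟧) 2, ← map_mul, one_div_mul_cancel two_ne_zero, map_one]
  rw [map_mul, map_sub, map_one, Polynomial.aeval_X, Polynomial.aeval_C, sqrtSeries_eq]
  linear_combination -treeSeries * hhalf

/-- The order of the pole at `X = 1/4` of the generating function `forestSeries σ`, in terms of
`√(1 - 4X)`. Truncated subtraction gives the order `0` for the empty forest. -/
def poleOrder (σ : List PlaneTree) : ℕ :=
  weight σ - 1

theorem weight_pos {σ : List PlaneTree} (hσ : σ ≠ []) : 0 < weight σ := by
  obtain ⟨⟨ss⟩, σ, rfl⟩ := List.exists_cons_of_ne_nil hσ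
  rw [weight_cons, weight_singleton]
  omega

theorem poleOrder_cons (ss σ : List PlaneTree) :
    poleOrder (node ss :: σ) = poleOrder ss + weight σ + 1 := by
  rw [poleOrder, poleOrder, weight_cons, weight_singleton]
  omega

theorem poleOrder_add_two (ss : List PlaneTree) :
    poleOrder ss + 2 = (node ss).size + (node ss).leaves := by
  have hweight := weight_singleton ss
  rw [weight, List.map_singleton, List.sum_singleton] at hweight
  rw [poleOrder, hweight]
  omega

theorem exists_hasLaurent_forestSeries (σ : List PlaneTree) :
    ∃ c > 0, HasLaurent sqrtSeries (forestSeries σ) (poleOrder σ) (c : ℝ) := by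
  induction hw : weight σ using Nat.strong_induction_on generalizing σ with
  | _ w ih =>
  subst hw
  obtain _ | ⟨⟨ss⟩, σ⟩ := σ
  · exact ⟨1 / 2, by norm_num, by rw [forestSeries_nil]; exact hasLaurent_treeSeries⟩
  rw [weight_cons, weight_singleton] at ih
  obtain ⟨a, ha, hfa⟩ := ih _ (by omega) ss rfl
  obtain ⟨b, hb, hfb⟩ := ih _ (by omega) σ rfl
  rw [poleOrder_cons]
  rcases eq_or_ne σ [] with rfl | hσ
  · refine ⟨a * b, mul_pos ha hb, .of_mul ?_⟩
    rw [sqrtSeries_mul_forestSeries, List.length_nil, Finset.sum_range_zero, add_zero]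
    exact hfa.mul hfb
  have hterm (k) (hk : k ∈ Finset.range σ.length) : ∃ c > 0, HasLaurent sqrtSeries
      (forestSeries (node ss :: σ.take k) * forestSeries (σ.drop k))
      (poleOrder ss + weight σ) (c : ℝ) := by
    have hsplit := weight_take_add_weight_drop k σ
    have hdrop : 0 < weight (σ.drop k) := weight_pos (by simpa using hk)
    obtain ⟨c, hc, hfc⟩ := ih _ (by rw [weight_cons, weight_singleton]; omega)
      (node ss :: σ.take k) rfl
    obtain ⟨d, hd, hfd⟩ := ih _ (by omega) (σ.drop k) rfl
    refine ⟨c * d, mul_pos hc hd, ?_⟩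
    have horder : poleOrder (node ss :: σ.take k) + poleOrder (σ.drop k) =
        poleOrder ss + weight σ := by
      rw [poleOrder_cons, poleOrder.eq_def (σ.drop k)]
      omega
    exact horder ▸ hfc.mul hfd
  choose! c hc hfc using hterm
  have horder : poleOrder ss + poleOrder σ < poleOrder ss + weight σ :=
    Nat.add_lt_add_left (Nat.sub_lt (weight_pos hσ) one_pos) _
  refine ⟨0 + ∑ k ∈ Finset.range σ.length, c k, ?_, .of_mul ?_⟩
  · rw [zero_add]
    exact Finset.sum_pos hc (by simpa using hσ)
  · rw [sqrtSeries_mul_forestSeries]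
    exact ((hfa.mul hfb).of_lt horder).add (.sum hfc)

theorem hasLaurent_embSeries {ss : List PlaneTree} {e : ℕ} {c : ℝ}
    (h : HasLaurent sqrtSeries (forestSeries ss) e c) :
    HasLaurent sqrtSeries (embSeries [node ss]) (e + 1) (c / 2) := by
  have hroot := sqrtSeries_mul_forestSeries ss []
  rw [forestSeries_nil, List.length_nil, Finset.sum_range_zero, add_zero] at hroot
  have hmul : sqrtSeries * embSeries [node ss] = forestSeries ss * (treeSeries + sqrtSeries) := by
    rw [embSeries_singleton]
    linear_combination hroot
  have hsqrt : HasLaurent sqrtSeries sqrtSeries 0 (0 : ℝ) := ⟨Polynomial.X, by simp, by simp⟩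
  refine .of_mul ?_
  simpa [hmul, div_eq_mul_inv] using h.mul (hasLaurent_treeSeries.add hsqrt)

theorem familyNumGoodEmb_eq_coeff (n : ℕ) (ss : List PlaneTree) :
    (familyNumGoodEmb n (node ss) : ℝ) = coeff n (forestSeries ss) := by
  rw [familyNumGoodEmb, Nat.cast_sum, forestSeries, coeff_genFun]
  exact Finset.sum_congr rfl fun ⟨ts⟩ _ => congrArg Nat.cast (numGoodEmb_node_node ss ts)

theorem familyNumEmb_eq_coeff (n : ℕ) (S : PlaneTree) :
    (familyNumEmb n S : ℝ) = coeff n (embSeries [S]) := by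
  rw [familyNumEmb, Nat.cast_sum, embSeries, coeff_genFun]
  exact Finset.sum_congr rfl fun T _ => congrArg Nat.cast (numEmb_eq_forestCount S T)

/-- The limit of the scaled ratio of good embeddings, for trees whose numbers of nodes and leaves
add up to `2k + 2`. Since Mathlib puts `Γ 0 = 0`, its value at the one-node tree, where `k = 0`, is
`0`. -/
noncomputable def limitRatio (k : ℝ) : ℝ :=
  2 * Real.Gamma (k + 1 / 2) / Real.Gamma k

theorem limitRatio_zero : limitRatio 0 = 0 := by
  rw [limitRatio, Real.Gamma_zero, div_zero]

theorem monotoneOn_limitRatio : MonotoneOn limitRatio (Set.Ici 0) := by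
  intro x hx y hy hxy
  rw [Set.mem_Ici] at hx hy
  have hpos {z : ℝ} (hz : 0 < z) : 0 < Real.Gamma z := Real.Gamma_pos_of_pos hz
  obtain rfl | hx := hx.eq_or_lt
  · rw [limitRatio_zero, limitRatio]
    exact div_nonneg (mul_nonneg zero_le_two (hpos (by linarith)).le)
      (Real.Gamma_nonneg_of_nonneg hy)
  have hlog := sub_le_sub_of_convexOn Real.convexOn_log_Gamma (h := 1 / 2)
    (Set.mem_Ioi.2 hx) (Set.mem_Ioi.2 (by linarith)) hxy one_half_pos
  have hΓx := hpos hx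
  have hΓy := hpos (hx.trans_le hxy)
  have hΓx' := hpos (by linarith : 0 < x + 1 / 2)
  have hΓy' := hpos (by linarith : 0 < y + 1 / 2)
  simp only [Function.comp_apply] at hlog
  rw [← Real.log_div hΓx'.ne' hΓx.ne', ← Real.log_div hΓy'.ne' hΓy.ne',
    Real.log_le_log_iff (div_pos hΓx' hΓx) (div_pos hΓy' hΓy)] at hlog
  rw [limitRatio, limitRatio, mul_div_assoc, mul_div_assoc]
  exact mul_le_mul_of_nonneg_left hlog zero_le_two

/-- The number `k = (m + l - 2) / 2` for a tree with `m` nodes and `l` leaves. -/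
noncomputable def exponent (S : PlaneTree) : ℝ :=
  ((S.size : ℝ) + (S.leaves : ℝ) - 2) / 2

theorem exponent_node (ss : List PlaneTree) : (node ss).exponent = poleOrder ss / 2 := by
  rw [exponent, ← Nat.cast_add, ← poleOrder_add_two, Nat.cast_add, Nat.cast_ofNat,
    add_sub_cancel_right]

theorem exponent_nonneg : ∀ S : PlaneTree, 0 ≤ S.exponent
  | node ss => by
    rw [exponent_node]
    positivity

theorem exponent_eq_zero_of_size_eq_one {S : PlaneTree} (hS : S.size = 1) : S.exponent = 0 := by
  obtain ⟨_ | ⟨s, ss⟩⟩ := S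
  · norm_num [exponent, size, leaves]
  · have hpos := s.size_pos
    simp only [size, List.map_cons, List.sum_cons] at hS
    omega

theorem Embeds.exponent_le {S T : PlaneTree} (h : S.Embeds T) : S.exponent ≤ T.exponent := by
  have hsum : ((S.size + S.leaves : ℕ) : ℝ) ≤ (T.size + T.leaves : ℕ) :=
    Nat.cast_le.2 h.size_add_leaves_le
  push_cast at hsum
  rw [exponent, exponent]
  linarith

theorem tendsto_scaledRatio (S : PlaneTree) :
    Tendsto S.scaledRatio atTop (𝓝 (limitRatio S.exponent)) := by
  obtain ⟨ss⟩ := S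
  obtain ⟨c, hc, hgood⟩ := exists_hasLaurent_forestSeries ss
  have hpos : 0 < Real.Gamma ((poleOrder ss + 1 : ℕ) / 2) := Real.Gamma_pos_of_pos (by positivity)
  have hlim := (hgood.tendsto_coeff four_ne_zero).div
    ((hasLaurent_embSeries hgood).tendsto_coeff four_ne_zero) (div_pos (half_pos hc) hpos).ne'
  have hlimit : c / Real.Gamma (poleOrder ss / 2) /
      (c / 2 / Real.Gamma ((poleOrder ss + 1 : ℕ) / 2)) = limitRatio (poleOrder ss / 2) := by
    rw [limitRatio, ← add_div, ← Nat.cast_succ]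
    field_simp
  rw [hlimit] at hlim
  rw [exponent_node]
  refine hlim.congr' ?_
  filter_upwards [eventually_gt_atTop 0] with n hn
  have hn : (0 : ℝ) < n := Nat.cast_pos.2 hn
  have hsqrt : √(n : ℝ) = (n : ℝ) ^ (1 - poleOrder ss / 2 : ℝ) /
      (n : ℝ) ^ (1 - (poleOrder ss + 1 : ℕ) / 2 : ℝ) := by
    rw [← Real.rpow_sub hn, Real.sqrt_eq_rpow]
    congr 1
    push_cast
    ring
  rw [Pi.div_apply, scaledRatio, familyNumGoodEmb_eq_coeff, familyNumEmb_eq_coeff, hsqrt]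
  field_simp

end PlaneTree

theorem mainTheorem10 :
    (∀ S : PlaneTree, 1 < S.size → ∀ k : ℝ, k = ((S.size : ℝ) + (S.leaves : ℝ) - 2) / 2 →
      Tendsto S.scaledRatio atTop (𝓝 (2 * Real.Gamma (k + 1 / 2) / Real.Gamma k))) ∧
    (∀ S : PlaneTree, S.size = 1 → Tendsto S.scaledRatio atTop (𝓝 0)) ∧
    (∀ S₁ S₂ : PlaneTree, S₁.Embeds S₂ →
      ∃ L₁ L₂ : ℝ, Tendsto S₁.scaledRatio atTop (𝓝 L₁) ∧
        Tendsto S₂.scaledRatio atTop (𝓝 L₂) ∧ L₁ ≤ L₂) := by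
  refine ⟨?_, ?_, ?_⟩
  · rintro S - k rfl
    exact S.tendsto_scaledRatio
  · intro S hS
    have hlim := S.tendsto_scaledRatio
    rwa [PlaneTree.exponent_eq_zero_of_size_eq_one hS, PlaneTree.limitRatio_zero] at hlim
  · intro S₁ S₂ hS
    exact ⟨_, _, S₁.tendsto_scaledRatio, S₂.tendsto_scaledRatio,
      PlaneTree.monotoneOn_limitRatio S₁.exponent_nonneg S₂.exponent_nonneg hS.exponent_le⟩
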